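/- Let $(d_j)_{j\ge 0}$ be a sequence of positive real numbers, put $c_j = 1 + d_j^2$, and let $J$ be the semi-infinite tridiagonal matrix \[ J=\begin{pmatrix} c_0 & d_0 & & \\ d_0 & c_1 & d_1 & \\ & d_1 & c_2 & \ddots \\ & & \ddots & \ddots \end{pmatrix}. \] Let $\ell^2$ be the Hilbert space of complex square summable sequences $x=(x_0,x_1,\dots)$ with inner product $(x,y)=\sum_{i\ge 0} x_i\overline{y_i}$, and denote by $J$ also the minimal closed operator in $\ell^2$ generated by this matrix, that is, the closure of the operator $x\mapsto Jx$ defined on the finitely supported sequences. Then the operator $J$ is self-adjoint and positive, that is, \[ (Jx,x)>0 \quad\text{for all } x\in\operatorname{dom} J\setminus\{0\}. \] In particular, $\ker J=\{0\}$. -/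

import Mathlib

open scoped ComplexOrder

noncomputable section

namespace JacobiOperator

/-- The Hilbert space `ℓ²` of complex square summable sequences `(x₀, x₁, …)`. -/
abbrev Ell2 : Type := lp (fun _ : ℕ => ℂ) 2

/-- The subspace of finitely supported sequences in `ℓ²`. -/
def finitelySupported : Submodule ℂ Ell2 where
  carrier := {x | (Function.support (x : ℕ → ℂ)).Finite}
  zero_mem' := by simp [Function.support]
  add_mem' := by
    intro x y hx hy
    refine (Set.Finite.union hx hy).subset ?_
    rw [lp.coeFn_add]
    exact Function.support_add _ _
  smul_mem' := by
    intro a x hx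
    refine Set.Finite.subset hx ?_
    rw [lp.coeFn_smul]
    exact Function.support_const_smul_subset a _

/-- The semi-infinite tridiagonal matrix with diagonal `c₀, c₁, …` and off-diagonal
`d₀, d₁, …` (both above and below the diagonal). -/
def tridiagonal (c d : ℕ → ℝ) : Matrix ℕ ℕ ℂ := fun i j =>
  if i = j then (c i : ℂ)
  else if j = i + 1 then (d i : ℂ)
  else if i = j + 1 then (d j : ℂ)
  else 0

/-- Every column of a tridiagonal matrix has finitely many nonzero entries. -/
theorem tridiagonal_column_finite (c d : ℕ → ℝ) (j : ℕ) :
    (Function.support fun i => tridiagonal c d i j).Finite := by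
  refine (Set.finite_Iic (j + 1)).subset ?_
  intro i hi
  by_contra h
  simp only [Set.mem_Iic, not_le] at h
  apply hi
  have h1 : i ≠ j := by omega
  have h2 : j ≠ i + 1 := by omega
  have h3 : i ≠ j + 1 := by omega
  simp [tridiagonal, h1, h2, h3]

/-- Terms of the matrix-vector product vanish off the support of the vector. -/
theorem summable_row (A : Matrix ℕ ℕ ℂ) (x : finitelySupported) (i : ℕ) :
    Summable fun j => A i j * (x : Ell2) j := by
  refine summable_of_hasFiniteSupport (Set.Finite.subset x.2 ?_)
  intro j hj h
  exact hj (by simp [h])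

/-- A column-finite matrix maps finitely supported sequences to finitely supported ones. -/
theorem mulVec_support_finite (A : Matrix ℕ ℕ ℂ)
    (hA : ∀ j, (Function.support fun i => A i j).Finite) (x : finitelySupported) :
    (Function.support fun i => ∑' j, A i j * (x : Ell2) j).Finite := by
  refine (Set.Finite.biUnion x.2 fun j _ => hA j).subset ?_
  intro i hi
  by_contra h
  apply hi
  have h0 : ∀ j, A i j * (x : Ell2) j = 0 := by
    intro j
    by_contra hj
    exact h (Set.mem_biUnion (x := j) (right_ne_zero_of_mul hj) (left_ne_zero_of_mul hj))
  simp [h0]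

/-- The operator `x ↦ A x` (matrix times column vector) with domain the finitely supported
sequences, for a matrix `A` with finitely many nonzero entries in each column. -/
def preminimal (A : Matrix ℕ ℕ ℂ) (hA : ∀ j, (Function.support fun i => A i j).Finite) :
    Ell2 →ₗ.[ℂ] Ell2 where
  domain := finitelySupported
  toFun :=
    { toFun := fun x =>
        ⟨fun i => ∑' j, A i j * (x : Ell2) j,
          (memℓp_zero (mulVec_support_finite A hA x)).of_exponent_ge zero_le⟩
      map_add' := by
        intro x y
        ext i
        simp only [Submodule.coe_add, lp.coeFn_add, Pi.add_apply, mul_add]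
        exact (summable_row A x i).tsum_add (summable_row A y i)
      map_smul' := by
        intro a x
        ext i
        simp only [Submodule.coe_smul, lp.coeFn_smul, Pi.smul_apply, smul_eq_mul,
          RingHom.id_apply, mul_left_comm _ a]
        exact tsum_mul_left }

/-- The minimal closed operator in `ℓ²` generated by the tridiagonal matrix with diagonal `c`
and off-diagonal `d`: the closure of the matrix operator on finitely supported sequences. -/
def minimalOperator (c d : ℕ → ℝ) : Ell2 →ₗ.[ℂ] Ell2 :=
  (preminimal (tridiagonal c d) (tridiagonal_column_finite c d)).closure

end JacobiOperator

end

/-!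
The matrix factors as `J = Bᴴ B + diag (cᵢ - 1 - dᵢ²)`, where `B` is lower bidiagonal with `1` on
the diagonal and `dᵢ` below it. Hence `(J x, x) ≥ ‖B x‖²` on finitely supported `x`; each estimate
`|(B x)ᵢ|² ≤ (J x, x)` passes to the closure, and positivity follows because `B x = 0` forces
`x = 0`.

A nonnegative symmetric operator is essentially self-adjoint once the range of `J + 1` has trivial
orthogonal complement. A vector `y` of that complement solves `J y = -y` coordinatewise, so summing
`(J y)ᵢ ȳᵢ` by parts over `i ≤ n` bounds `∑_{i ≤ n} |yᵢ|²` by the boundary term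
`-dₙ Re ((dₙ yₙ + yₙ₊₁) ȳₙ) ≤ |yₙ₊₁|² / 4`. As `yₙ₊₁ → 0`, this gives `y = 0`.
-/

open Filter Finset Topology
open scoped ComplexConjugate InnerProductSpace

namespace JacobiOperator

theorem mk_closure_mem_of_isClosed {R E F : Type*} [CommRing R] [TopologicalSpace R]
    [AddCommGroup E] [Module R E] [TopologicalSpace E] [ContinuousAdd E] [ContinuousSMul R E]
    [AddCommGroup F] [Module R F] [TopologicalSpace F] [ContinuousAdd F] [ContinuousSMul R F]
    {T : E →ₗ.[R] F} {S : Set (E × F)} (hS : IsClosed S) (hT : ∀ x : T.domain, (↑x, T x) ∈ S)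
    (x : T.closure.domain) : (↑x, T.closure x) ∈ S := by
  have hgraph : (T.graph : Set (E × F)) ⊆ S := by
    intro p hp
    obtain ⟨y, rfl⟩ := T.mem_graph_iff'.1 hp
    exact hT y
  have hgraph_closure : (T.closure.graph : Set (E × F)) ⊆ S := by
    by_cases hcl : T.IsClosable
    · rw [← hcl.graph_closure_eq_closure_graph]
      exact closure_minimal hgraph hS
    · rwa [LinearPMap.closure_def' hcl]
  exact hgraph_closure (T.closure.mem_graph x)

section EssentialSelfAdjointness

variable {𝕜 E F : Type*} [RCLike 𝕜] [NormedAddCommGroup E] [InnerProductSpace 𝕜 E]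
  [NormedAddCommGroup F] [InnerProductSpace 𝕜 F]

theorem isFormalAdjoint_closure {T : E →ₗ.[𝕜] F} {S : F →ₗ.[𝕜] E} (h : T.IsFormalAdjoint S) :
    T.closure.IsFormalAdjoint S.closure := by
  have hT : ∀ (x : T.closure.domain) (y : S.domain),
      ⟪T.closure x, (y : F)⟫_𝕜 = ⟪(x : E), S y⟫_𝕜 := fun x y =>
    mk_closure_mem_of_isClosed (S := {p | ⟪p.2, (y : F)⟫_𝕜 = ⟪p.1, S y⟫_𝕜})
      (isClosed_eq (by fun_prop) (by fun_prop)) (fun x => h x y) x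
  exact fun x y =>
    mk_closure_mem_of_isClosed (S := {p | ⟪T.closure x, p.1⟫_𝕜 = ⟪(x : E), p.2⟫_𝕜})
      (isClosed_eq (by fun_prop) (by fun_prop)) (hT x) y

theorem isClosable_of_isFormalAdjoint [CompleteSpace F] {T : E →ₗ.[𝕜] F} {S : F →ₗ.[𝕜] E}
    (hS : Dense (S.domain : Set F)) (h : S.IsFormalAdjoint T) : T.IsClosable :=
  (LinearPMap.adjoint_isClosed hS).isClosable.leIsClosable (h.le_adjoint hS)

theorem norm_le_norm_add_of_re_inner_nonneg {x y : E} (h : 0 ≤ RCLike.re ⟪x, y⟫_𝕜) :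
    ‖x‖ ≤ ‖x + y‖ := by
  have hsq := norm_add_sq (𝕜 := 𝕜) x y
  exact le_of_sq_le_sq (by nlinarith [sq_nonneg ‖y‖]) (norm_nonneg _)

theorem isSelfAdjoint_of_range_id_add_eq_top [CompleteSpace E] {T : E →ₗ.[𝕜] E}
    (hT : Dense (T.domain : Set E)) (hsymm : T.IsFormalAdjoint T)
    (hrange : LinearMap.range (T.domain.subtype + T.toFun) = ⊤) : IsSelfAdjoint T := by
  have hsurj : ∀ z : E, ∃ x : T.domain, (x : E) + T x = z := LinearMap.range_eq_top.1 hrange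
  have hle : T ≤ T.adjoint := hsymm.le_adjoint hT
  refine (LinearPMap.eq_of_le_of_domain_eq hle (hle.1.antisymm fun y hy => ?_)).symm
  obtain ⟨x, hx⟩ := hsurj (y + T.adjoint ⟨y, hy⟩)
  have horth : ∀ u : T.domain, ⟪y - x, (u : E) + T u⟫_𝕜 = 0 := by
    intro u
    calc ⟪y - x, (u : E) + T u⟫_𝕜
        = ⟪y + T.adjoint ⟨y, hy⟩, (u : E)⟫_𝕜 - ⟪(x : E) + T x, (u : E)⟫_𝕜 := by
          rw [inner_sub_left, inner_add_right, inner_add_right, inner_add_left, inner_add_left,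
            LinearPMap.adjoint_isFormalAdjoint hT ⟨y, hy⟩ u, hsymm x u]
      _ = 0 := by rw [hx, sub_self]
  obtain ⟨u, hu⟩ := hsurj (y - x)
  have hyx : y = x := by
    rw [← sub_eq_zero, ← inner_self_eq_zero (𝕜 := 𝕜)]
    nth_rewrite 2 [← hu]
    exact horth u
  exact hyx ▸ x.2

theorem isClosed_range_id_add_of_re_inner_nonneg [CompleteSpace E] {T : E →ₗ.[𝕜] E}
    (hcl : T.IsClosed) (hpos : ∀ x : T.domain, 0 ≤ RCLike.re ⟪(x : E), T x⟫_𝕜) :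
    IsClosed (LinearMap.range (T.domain.subtype + T.toFun) : Set E) := by
  have hgraph : IsClosed (T.graph : Set (E × E)) := hcl
  have : CompleteSpace T.graph := hgraph.completeSpace_coe
  let f : T.graph →L[𝕜] E :=
    (ContinuousLinearMap.fst 𝕜 E E + ContinuousLinearMap.snd 𝕜 E E).comp T.graph.subtypeL
  have hbound : ∀ p : T.graph, ‖p‖ ≤ (1 : NNReal) * ‖f p‖ := by
    rintro ⟨p, hp⟩
    obtain ⟨x, rfl⟩ := T.mem_graph_iff'.1 hp
    rw [NNReal.coe_one, one_mul]
    refine max_le (norm_le_norm_add_of_re_inner_nonneg (hpos x)) ?_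
    change ‖T x‖ ≤ ‖(x : E) + T x‖
    rw [add_comm]
    exact norm_le_norm_add_of_re_inner_nonneg (inner_re_symm (𝕜 := 𝕜) (x : E) (T x) ▸ hpos x)
  have hrange : (LinearMap.range (T.domain.subtype + T.toFun) : Set E) = Set.range f := by
    ext z
    constructor
    · rintro ⟨x, rfl⟩
      exact ⟨⟨_, T.mem_graph x⟩, rfl⟩
    · rintro ⟨⟨p, hp⟩, rfl⟩
      obtain ⟨x, rfl⟩ := T.mem_graph_iff'.1 hp
      exact ⟨x, rfl⟩
  rw [hrange]
  exact (f.antilipschitz_of_bound hbound).isClosed_range f.uniformContinuous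

theorem isSelfAdjoint_closure_of_orthogonal_range_id_add_eq_bot [CompleteSpace E]
    {T : E →ₗ.[𝕜] E} (hT : Dense (T.domain : Set E)) (hsymm : T.IsFormalAdjoint T)
    (hpos : ∀ x : T.domain, 0 ≤ RCLike.re ⟪(x : E), T x⟫_𝕜)
    (hperp : (LinearMap.range (T.domain.subtype + T.toFun))ᗮ = ⊥) :
    IsSelfAdjoint T.closure := by
  have hle : T ≤ T.closure := T.le_closure
  have hpos' : ∀ x : T.closure.domain, 0 ≤ RCLike.re ⟪(x : E), T.closure x⟫_𝕜 :=
    mk_closure_mem_of_isClosed (S := {p : E × E | 0 ≤ RCLike.re ⟪p.1, p.2⟫_𝕜})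
      (isClosed_le continuous_const (by fun_prop)) hpos
  let K : Submodule 𝕜 E := LinearMap.range (T.closure.domain.subtype + T.closure.toFun)
  have hK : IsClosed (K : Set E) := isClosed_range_id_add_of_re_inner_nonneg
    (isClosable_of_isFormalAdjoint hT hsymm).closure_isClosed hpos'
  have hrange : LinearMap.range (T.domain.subtype + T.toFun) ≤ K := by
    rintro _ ⟨x, rfl⟩
    exact ⟨⟨x, hle.1 x.2⟩, congrArg ((x : E) + ·) (hle.2 rfl).symm⟩
  have : CompleteSpace K := hK.completeSpace_coe
  refine isSelfAdjoint_of_range_id_add_eq_top (hT.mono hle.1) (isFormalAdjoint_closure hsymm) ?_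
  exact Submodule.orthogonal_eq_bot_iff.1 (le_bot_iff.1 (hperp ▸ Submodule.orthogonal_le hrange))

end EssentialSelfAdjointness

/-- The `k`-th standard unit vector, as an element of the domain of the preminimal operators. -/
noncomputable def unitVector (k : ℕ) : finitelySupported :=
  ⟨lp.single 2 k 1, (Set.finite_singleton k).subset fun j hj => by
    contrapose! hj
    exact Function.notMem_support.2 (lp.single_apply_ne 2 k 1 hj)⟩

theorem inner_unitVector (y : Ell2) (k : ℕ) : ⟪y, (unitVector k : Ell2)⟫_ℂ = conj (y k) := by
  rw [unitVector, lp.inner_single_right, RCLike.inner_apply, one_mul]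

theorem dense_finitelySupported : Dense (finitelySupported : Set Ell2) := by
  intro x
  refine mem_closure_of_tendsto (lp.hasSum_single (by simp) x) (Eventually.of_forall fun s => ?_)
  refine Submodule.sum_mem _ fun k _ => ?_
  have hsingle : (lp.single 2 k (x k) : Ell2) = x k • (unitVector k : Ell2) := by
    rw [unitVector, ← lp.single_smul, smul_eq_mul, mul_one]
  exact hsingle ▸ Submodule.smul_mem _ _ (unitVector k).2

theorem eq_sum_smul_unitVector (x : finitelySupported) :
    x = ∑ k ∈ x.2.toFinset, (x : Ell2) k • unitVector k := by
  ext i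
  rw [AddSubmonoidClass.coe_finsetSum, lp.coeFn_sum, Finset.sum_apply]
  simpa [unitVector, Pi.single_apply] using fun hi => by_contra fun h => hi (x.2.mem_toFinset.2 h)

theorem linearMap_ext_unitVector {M : Type*} [AddCommMonoid M] [Module ℂ M]
    {φ ψ : finitelySupported →ₗ[ℂ] M} (h : ∀ k, φ (unitVector k) = ψ (unitVector k)) : φ = ψ := by
  ext x
  rw [eq_sum_smul_unitVector x]
  simp only [map_sum, map_smul, h]

theorem exists_forall_ge_eq_zero (x : finitelySupported) :
    ∃ N, ∀ n, N ≤ n → (x : Ell2) n = 0 := by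
  obtain ⟨N, hN⟩ := x.2.bddAbove
  exact ⟨N + 1, fun n hn => by_contra fun h => absurd (hN h) (by omega)⟩

section HermitianMatrix

variable {A : Matrix ℕ ℕ ℂ} {hA : ∀ j, (Function.support fun i => A i j).Finite}

/-- The product of an infinite matrix with an arbitrary sequence, which extends the action of
`preminimal` to vectors outside its domain; a row whose series diverges yields the junk value `0`,
which cannot happen for a matrix with finite rows. -/
noncomputable def formalMulVec (A : Matrix ℕ ℕ ℂ) (x : ℕ → ℂ) (i : ℕ) : ℂ := ∑' j, A i j * x j

theorem inner_preminimal (y : Ell2) (x : finitelySupported) :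
    ⟪y, preminimal A hA x⟫_ℂ = ∑' i, formalMulVec A x i * conj (y i) :=
  lp.inner_eq_tsum _ _

theorem inner_preminimal_unitVector (hherm : A.IsHermitian) (y : Ell2) (k : ℕ) :
    ⟪y, preminimal A hA (unitVector k)⟫_ℂ = conj (formalMulVec A y k) := by
  have hcolumn : ∀ i, formalMulVec A (unitVector k : Ell2) i = A i k := by
    intro i
    rw [formalMulVec, tsum_eq_single k]
    · simp [unitVector]
    · intro j hj
      simp [unitVector, hj]
  rw [inner_preminimal, formalMulVec, Complex.conj_tsum]
  refine tsum_congr fun i => ?_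
  rw [hcolumn, map_mul, ← hherm.apply i k, Complex.star_def]

theorem isFormalAdjoint_preminimal (hherm : A.IsHermitian) :
    (preminimal A hA).IsFormalAdjoint (preminimal A hA) := by
  intro x
  refine LinearMap.congr_fun (linearMap_ext_unitVector
    (φ := (innerₛₗ ℂ (preminimal A hA x)).comp finitelySupported.subtype)
    (ψ := (innerₛₗ ℂ (x : Ell2)).comp (preminimal A hA).toFun) fun k => ?_)
  change ⟪preminimal A hA x, (unitVector k : Ell2)⟫_ℂ =
    ⟪(x : Ell2), preminimal A hA (unitVector k)⟫_ℂ
  rw [inner_unitVector, inner_preminimal_unitVector hherm]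
  rfl

theorem formalMulVec_eq_neg_of_mem_orthogonal (hherm : A.IsHermitian) {y : Ell2}
    (hy : y ∈ (LinearMap.range ((preminimal A hA).domain.subtype + (preminimal A hA).toFun))ᗮ)
    (k : ℕ) : formalMulVec A y k = -y k := by
  have h : ⟪y, (unitVector k : Ell2) + preminimal A hA (unitVector k)⟫_ℂ = 0 :=
    Submodule.inner_left_of_mem_orthogonal (LinearMap.mem_range_self _ (unitVector k)) hy
  rw [inner_add_right, inner_unitVector, inner_preminimal_unitVector hherm, ← map_add,
    map_eq_zero] at h
  exact eq_neg_of_add_eq_zero_right h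

end HermitianMatrix

section TridiagonalOperator

variable {c d : ℕ → ℝ}

/-- The action on an arbitrary sequence of the lower bidiagonal matrix `B` with `1` on the diagonal
and `d` below it, for which `Bᴴ B` is the tridiagonal matrix with `cⱼ = 1 + dⱼ²`. -/
def bidiagonalMulVec (d : ℕ → ℝ) (x : ℕ → ℂ) : ℕ → ℂ
  | 0 => x 0
  | i + 1 => d i * x i + x (i + 1)

theorem eq_zero_of_bidiagonalMulVec_eq_zero {x : ℕ → ℂ} (h : ∀ i, bidiagonalMulVec d x i = 0)
    (i : ℕ) : x i = 0 := by
  induction i with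
  | zero => exact h 0
  | succ i ih => simpa [bidiagonalMulVec, ih] using h (i + 1)

theorem tridiagonal_self (c d : ℕ → ℝ) (i : ℕ) : tridiagonal c d i i = c i := by
  simp [tridiagonal]

theorem tridiagonal_self_succ (c d : ℕ → ℝ) (i : ℕ) : tridiagonal c d i (i + 1) = d i := by
  simp [tridiagonal]

theorem tridiagonal_succ_self (c d : ℕ → ℝ) (i : ℕ) : tridiagonal c d (i + 1) i = d i := by
  rw [tridiagonal, if_neg (by omega), if_neg (by omega), if_pos rfl]

theorem isHermitian_tridiagonal (c d : ℕ → ℝ) : (tridiagonal c d).IsHermitian := by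
  ext i j
  simp only [Matrix.conjTranspose_apply, tridiagonal, apply_ite star, Complex.star_def,
    Complex.conj_ofReal, map_zero]
  grind

theorem formalMulVec_tridiagonal (c d : ℕ → ℝ) (x : ℕ → ℂ) (i : ℕ) :
    formalMulVec (tridiagonal c d) x i =
      bidiagonalMulVec d x i + d i * bidiagonalMulVec d x (i + 1) +
        (c i - 1 - d i ^ 2) * x i := by
  have hzero : ∀ {j}, j ≠ i → j ≠ i + 1 → i ≠ j + 1 → tridiagonal c d i j * x j = 0 := by
    intro j hdiag hupper hlower
    rw [tridiagonal, if_neg hdiag.symm, if_neg hupper, if_neg hlower, zero_mul]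
  rw [formalMulVec]
  cases i with
  | zero =>
    rw [tsum_eq_sum (s := {0, 0 + 1}) fun j hj => hzero (by grind) (by grind) (by grind),
      sum_pair (by simp), tridiagonal_self, tridiagonal_self_succ]
    simp only [bidiagonalMulVec]
    ring
  | succ k =>
    rw [tsum_eq_sum (s := {k, k + 1, k + 1 + 1}) fun j hj =>
      hzero (by grind) (by grind) (by grind), sum_insert (by simp [add_assoc]), sum_pair (by simp),
      tridiagonal_succ_self, tridiagonal_self, tridiagonal_self_succ]
    simp only [bidiagonalMulVec]
    ring

theorem sum_formalMulVec_tridiagonal_mul_conj (c d : ℕ → ℝ) (x : ℕ → ℂ) (n : ℕ) :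
    ∑ i ∈ range (n + 1), formalMulVec (tridiagonal c d) x i * conj (x i) =
      ∑ i ∈ range (n + 1), (‖bidiagonalMulVec d x i‖ ^ 2 + (c i - 1 - d i ^ 2) * ‖x i‖ ^ 2 : ℂ) +
        d n * bidiagonalMulVec d x (n + 1) * conj (x n) := by
  simp only [formalMulVec_tridiagonal, ← Complex.mul_conj']
  induction n with
  | zero =>
    simp only [zero_add, range_one, sum_singleton, bidiagonalMulVec]
    ring
  | succ n ih =>
    rw [sum_range_succ, ih, sum_range_succ _ (n + 1)]
    simp only [bidiagonalMulVec, map_add, map_mul, Complex.conj_ofReal]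
    ring

theorem sum_norm_sq_bidiagonalMulVec_le (hc : ∀ j, 1 + d j ^ 2 ≤ c j) (x : ℕ → ℂ) (n : ℕ) :
    ∑ i ∈ range (n + 1), ‖bidiagonalMulVec d x i‖ ^ 2 +
        (d n * bidiagonalMulVec d x (n + 1) * conj (x n)).re ≤
      (∑ i ∈ range (n + 1), formalMulVec (tridiagonal c d) x i * conj (x i)).re := by
  rw [sum_formalMulVec_tridiagonal_mul_conj, Complex.add_re, Complex.re_sum]
  gcongr with i
  norm_cast
  exact le_add_of_nonneg_right (mul_nonneg (by linarith [hc i]) (sq_nonneg _))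

theorem four_mul_sum_norm_sq_le_of_formalMulVec_eq_neg (hc : ∀ j, 1 + d j ^ 2 ≤ c j) {y : ℕ → ℂ}
    (hy : ∀ i, formalMulVec (tridiagonal c d) y i = -y i) (n : ℕ) :
    4 * ∑ i ∈ range (n + 1), ‖y i‖ ^ 2 ≤ ‖y (n + 1)‖ ^ 2 := by
  have hform : ∑ i ∈ range (n + 1), ‖bidiagonalMulVec d y i‖ ^ 2 +
      (d n * bidiagonalMulVec d y (n + 1) * conj (y n)).re ≤ -∑ i ∈ range (n + 1), ‖y i‖ ^ 2 := by
    convert! sum_norm_sq_bidiagonalMulVec_le hc y n using 1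
    simp only [hy, neg_mul, Complex.mul_conj', sum_neg_distrib, Complex.neg_re]
    norm_cast
  have hsquare : 0 ≤ ∑ i ∈ range (n + 1), ‖bidiagonalMulVec d y i‖ ^ 2 := by positivity
  have hboundary : 4 * (d n * bidiagonalMulVec d y (n + 1) * conj (y n)).re + ‖y (n + 1)‖ ^ 2 =
      ‖2 * (d n * y n) + y (n + 1)‖ ^ 2 := by
    simp only [bidiagonalMulVec, ← Complex.normSq_eq_norm_sq, Complex.normSq_apply,
      Complex.mul_re, Complex.mul_im, Complex.add_re, Complex.add_im, Complex.conj_re,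
      Complex.conj_im, Complex.ofReal_re, Complex.ofReal_im, Complex.re_ofNat, Complex.im_ofNat]
    ring
  linarith [sq_nonneg ‖2 * (d n * y n) + y (n + 1)‖]

theorem tendsto_coord_atTop_zero (y : Ell2) : Tendsto (fun i => y i) atTop (𝓝 0) := by
  have hsum : Summable fun i => ‖y i‖ ^ 2 := by
    simpa using (lp.memℓp y).summable (by simp)
  rw [tendsto_zero_iff_norm_tendsto_zero]
  simpa using hsum.tendsto_atTop_zero.sqrt

theorem eq_zero_of_formalMulVec_tridiagonal_eq_neg (hc : ∀ j, 1 + d j ^ 2 ≤ c j) {y : Ell2}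
    (hy : ∀ i, formalMulVec (tridiagonal c d) y i = -y i) : y = 0 := by
  have hnext : Tendsto (fun n => ‖y (n + 1)‖ ^ 2) atTop (𝓝 0) := by
    simpa using ((tendsto_coord_atTop_zero y).comp (tendsto_add_atTop_nat 1)).norm.pow 2
  ext i
  have hle : ‖y i‖ ^ 2 ≤ 0 := by
    refine ge_of_tendsto hnext ((eventually_ge_atTop i).mono fun n hn => ?_)
    have hterm : ‖y i‖ ^ 2 ≤ ∑ j ∈ range (n + 1), ‖y j‖ ^ 2 :=
      single_le_sum (f := fun j => ‖y j‖ ^ 2) (fun _ _ => sq_nonneg _)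
        (mem_range.2 (Nat.lt_succ_of_le hn))
    linarith [four_mul_sum_norm_sq_le_of_formalMulVec_eq_neg hc hy n, sq_nonneg ‖y i‖]
  simpa using hle.antisymm (sq_nonneg _)

theorem norm_sq_bidiagonalMulVec_le_re_inner_preminimal (hc : ∀ j, 1 + d j ^ 2 ≤ c j) (i : ℕ)
    (x : finitelySupported) :
    ‖bidiagonalMulVec d (x : Ell2) i‖ ^ 2 ≤
      (⟪(x : Ell2), preminimal _ (tridiagonal_column_finite c d) x⟫_ℂ).re := by
  obtain ⟨N, hN⟩ := exists_forall_ge_eq_zero x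
  have hsum := sum_norm_sq_bidiagonalMulVec_le hc (x : Ell2) (max N i)
  rw [hN _ (le_max_left N i), map_zero, mul_zero, Complex.zero_re, add_zero] at hsum
  rw [inner_preminimal, tsum_eq_sum (s := range (max N i + 1))]
  · exact (single_le_sum (f := fun j => ‖bidiagonalMulVec d (x : Ell2) j‖ ^ 2)
      (fun _ _ => sq_nonneg _) (mem_range.2 (by omega))).trans hsum
  · intro j hj
    rw [mem_range] at hj
    rw [hN j (by omega), map_zero, mul_zero]

theorem continuous_bidiagonalMulVec (d : ℕ → ℝ) (i : ℕ) :
    Continuous fun x : Ell2 => bidiagonalMulVec d x i := by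
  have hcoord : ∀ j, Continuous fun x : Ell2 => x j := fun j => (lp.evalCLM ℂ _ 2 j).continuous
  cases i with
  | zero => exact hcoord 0
  | succ i => exact (continuous_const.mul (hcoord i)).add (hcoord (i + 1))

theorem norm_sq_bidiagonalMulVec_le_re_inner_minimalOperator (hc : ∀ j, 1 + d j ^ 2 ≤ c j)
    (x : (minimalOperator c d).domain) (i : ℕ) :
    ‖bidiagonalMulVec d (x : Ell2) i‖ ^ 2 ≤ (⟪(x : Ell2), minimalOperator c d x⟫_ℂ).re := by
  have hclosed : IsClosed {p : Ell2 × Ell2 | ‖bidiagonalMulVec d p.1 i‖ ^ 2 ≤ (⟪p.1, p.2⟫_ℂ).re} :=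
    isClosed_le (((continuous_bidiagonalMulVec d i).comp continuous_fst).norm.pow 2)
      (Complex.continuous_re.comp (by fun_prop))
  exact mk_closure_mem_of_isClosed hclosed
    (norm_sq_bidiagonalMulVec_le_re_inner_preminimal hc i) x

theorem isSelfAdjoint_minimalOperator (hc : ∀ j, 1 + d j ^ 2 ≤ c j) :
    IsSelfAdjoint (minimalOperator c d) := by
  have hherm := isHermitian_tridiagonal c d
  refine isSelfAdjoint_closure_of_orthogonal_range_id_add_eq_bot dense_finitelySupported
    (isFormalAdjoint_preminimal hherm) (fun x => ?_) ((Submodule.eq_bot_iff _).2 fun y hy => ?_)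
  · exact (sq_nonneg _).trans (norm_sq_bidiagonalMulVec_le_re_inner_preminimal hc 0 x)
  · exact eq_zero_of_formalMulVec_tridiagonal_eq_neg hc
      (formalMulVec_eq_neg_of_mem_orthogonal hherm hy)

theorem inner_minimalOperator_pos (hc : ∀ j, 1 + d j ^ 2 ≤ c j)
    {x : (minimalOperator c d).domain} (hx : x ≠ 0) :
    0 < ⟪(x : Ell2), minimalOperator c d x⟫_ℂ := by
  have hle := norm_sq_bidiagonalMulVec_le_re_inner_minimalOperator hc x
  have hreal : (⟪(x : Ell2), minimalOperator c d x⟫_ℂ).im = 0 := by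
    rw [← Complex.conj_eq_iff_im, inner_conj_symm]
    exact isFormalAdjoint_closure (isFormalAdjoint_preminimal (isHermitian_tridiagonal c d)) x x
  refine Complex.pos_iff.2 ⟨((sq_nonneg _).trans (hle 0)).lt_of_ne fun h0 => hx ?_, hreal.symm⟩
  have hB : ∀ i, bidiagonalMulVec d (x : Ell2) i = 0 := fun i => by
    simpa [← h0] using hle i
  exact Subtype.ext (lp.ext (funext (eq_zero_of_bidiagonalMulVec_eq_zero hB)))

end TridiagonalOperator

end JacobiOperator

open JacobiOperator in
theorem mainTheorem5_general (c d : ℕ → ℝ) (hc : ∀ j, 1 + d j ^ 2 ≤ c j) :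
    IsSelfAdjoint (minimalOperator c d) ∧
    (∀ x : (minimalOperator c d).domain, x ≠ 0 →
      0 < ⟪(x : Ell2), minimalOperator c d x⟫_ℂ) ∧
    LinearMap.ker (minimalOperator c d).toFun = ⊥ := by
  have hpos : ∀ x : (minimalOperator c d).domain, x ≠ 0 →
      0 < ⟪(x : Ell2), minimalOperator c d x⟫_ℂ := fun _ => inner_minimalOperator_pos hc
  refine ⟨isSelfAdjoint_minimalOperator hc, hpos, LinearMap.ker_eq_bot'.2 fun x hx => ?_⟩
  by_contra hne
  have hx' : minimalOperator c d x = 0 := hx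
  exact (hpos x hne).ne' (hx' ▸ inner_zero_right _)

theorem mainTheorem5 (c d : ℕ → ℝ) (hd : ∀ j, 0 < d j) (hc : ∀ j, c j = 1 + d j ^ 2) :
    IsSelfAdjoint (JacobiOperator.minimalOperator c d) ∧
    (∀ x : (JacobiOperator.minimalOperator c d).domain, x ≠ 0 →
      0 < inner ℂ (x : JacobiOperator.Ell2) (JacobiOperator.minimalOperator c d x)) ∧
    LinearMap.ker (JacobiOperator.minimalOperator c d).toFun = ⊥ :=
  mainTheorem5_general c d fun j => (hc j).ge
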